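/- A (locally compact) hypergroup is a locally compact Hausdorff space $K$ together with an associative bilinear convolution $*$ of bounded regular Borel measures, given by $(\mu*\nu)(A)=\iint(\delta_x*\delta_y)(A)\,d\mu(x)\,d\nu(y)$, such that: each $\delta_x*\delta_y$ is a probability measure with compact support; $(x,y)\mapsto\delta_x*\delta_y$ is continuous for the weak topology; $(x,y)\mapsto\operatorname{supp}(\delta_x*\delta_y)$ is continuous into the nonempty compact subsets of $K$ with the Michael (Vietoris) topology; there is $e\in K$ with $\delta_e*\delta_x=\delta_x*\delta_e=\delta_x$ for all $x$; and there is a homeomorphism $x\mapsto x^-$ of $K$ with $(x^-)^-=x$, with the image of $\delta_x*\delta_y$ under it equal to $\delta_{y^-}*\delta_{x^-}$, and with $e\in\operatorname{supp}(\delta_x*\delta_y)$ if and only if $x=y^-$. A right-invariant Haar measure on $K$ is a nonzero positive Radon measure $m$ with $m*\delta_x=m$ for all $x\in K$. Let $\mathcal P(K)$ be the space of regular Borel probability measures on $K$ with the weak topology (tested on bounded continuous functions). $K$ has the normed convergence property if for every sequence $(\mu_n)_{n\ge1}$ in $\mathcal P(K)$ there is a sequence $(x_n)_{n\ge1}$ in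 $K$ such that $(\delta_{x_n}*\nu_n)_{n\ge1}$ is relatively compact in $\mathcal P(K)$, where $\nu_n=\mu_n*\cdots*\mu_2*\mu_1$. **Theorem.** Let $K$ be a hypergroup whose topology has a countable basis and which admits a right-invariant Haar measure. Then $K$ has the normed convergence property if and only if $K$ is compact. -/

import Mathlib

open MeasureTheory Topology

noncomputable section

namespace Hypergroup

variable {K : Type*} [TopologicalSpace K] [T2Space K] [LocallyCompactSpace K]
  [SecondCountableTopology K] [MeasurableSpace K] [BorelSpace K]

/-- The bilinear extension to measures of a family `c x y` (`= δ_x * δ_y`) of probability measures: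
`(μ * ν)(A) = ∫∫ (c x y)(A) dμ(x) dν(y)`. -/
def extendConv (c : K → K → ProbabilityMeasure K) (μ ν : Measure K) : Measure K :=
  (μ.prod ν).bind fun p => (c p.1 p.2 : Measure K)

/-- A weakly continuous family of probability measures is measurable. -/
theorem measurable_of_continuous {c : K → K → ProbabilityMeasure K}
    (hc : Continuous fun p : K × K => c p.1 p.2) :
    Measurable fun p : K × K => (c p.1 p.2 : Measure K) := by
  refine Measurable.measure_of_isPiSystem_of_isProbabilityMeasure
    (S := {s | IsOpen s}) (BorelSpace.measurable_eq (α := K)) isPiSystem_isOpen ?_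
  intro U hU
  refine LowerSemicontinuous.measurable ?_
  rw [lowerSemicontinuous_iff_le_liminf]
  intro p
  exact ProbabilityMeasure.le_liminf_measure_open_of_tendsto (hc.tendsto p) hU

theorem isProbabilityMeasure_extendConv {c : K → K → ProbabilityMeasure K}
    (hc : Continuous fun p : K × K => c p.1 p.2) (μ ν : Measure K)
    [IsProbabilityMeasure μ] [IsProbabilityMeasure ν] :
    IsProbabilityMeasure (extendConv c μ ν) := by
  constructor
  rw [extendConv, Measure.bind_apply MeasurableSet.univ (measurable_of_continuous hc).aemeasurable]
  simp

end Hypergroup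

/-- A (locally compact) hypergroup in the sense of Dunkl, Jewett and Spector, on a second countable
locally compact Hausdorff space `K`. On such a space every finite Borel measure is regular. The
bilinear convolution of bounded measures is determined by the measures `δ_x * δ_y`. -/
class Hypergroup (K : Type*) [TopologicalSpace K] [T2Space K] [LocallyCompactSpace K]
    [SecondCountableTopology K] [MeasurableSpace K] [BorelSpace K] where
  /-- The convolution `δ_x * δ_y`, a probability measure. -/
  pointConv : K → K → ProbabilityMeasure K
  /-- The identity element. -/
  e : K
  /-- The involution `x ↦ x⁻`. -/
  invol : K → K
  /-- `(x, y) ↦ δ_x * δ_y` is continuous for the weak topology. -/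
  continuous_pointConv : Continuous fun p : K × K => pointConv p.1 p.2
  /-- `(δ_x * δ_y) * δ_z = δ_x * (δ_y * δ_z)`. -/
  pointConv_assoc : ∀ x y z : K,
    Hypergroup.extendConv pointConv (pointConv x y) (Measure.dirac z) =
      Hypergroup.extendConv pointConv (Measure.dirac x) (pointConv y z)
  /-- `δ_x * δ_y` has compact support. -/
  isCompact_support : ∀ x y : K, IsCompact (pointConv x y : Measure K).support
  /-- `(x, y) ↦ supp (δ_x * δ_y)` is continuous for the Michael (Vietoris) topology on the
  nonempty compact sets, which is induced by the Vietoris topology on all subsets. -/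
  continuous_support : @Continuous (K × K) (Set K) _ (TopologicalSpace.vietoris K)
    fun p => (pointConv p.1 p.2 : Measure K).support
  /-- `δ_e * δ_x = δ_x`. -/
  e_pointConv : ∀ x : K, (pointConv e x : Measure K) = Measure.dirac x
  /-- `δ_x * δ_e = δ_x`. -/
  pointConv_e : ∀ x : K, (pointConv x e : Measure K) = Measure.dirac x
  /-- The involution is continuous (hence a homeomorphism, being its own inverse). -/
  continuous_invol : Continuous invol
  /-- `(x⁻)⁻ = x`. -/
  invol_invol : ∀ x : K, invol (invol x) = x
  /-- `(δ_x * δ_y)⁻ = δ_{y⁻} * δ_{x⁻}`. -/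
  map_invol_pointConv : ∀ x y : K,
    (pointConv x y : Measure K).map invol = pointConv (invol y) (invol x)
  /-- `e ∈ supp (δ_x * δ_y)` if and only if `x = y⁻`. -/
  e_mem_support_iff : ∀ x y : K, e ∈ (pointConv x y : Measure K).support ↔ x = invol y

namespace Hypergroup

variable {K : Type*} [TopologicalSpace K] [T2Space K] [LocallyCompactSpace K]
  [SecondCountableTopology K] [MeasurableSpace K] [BorelSpace K] [Hypergroup K]

/-- The convolution `μ * ν` of two (σ-finite) measures on a hypergroup. -/
def convMeasure (μ ν : Measure K) : Measure K :=
  extendConv Hypergroup.pointConv μ ν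

/-- The convolution of two probability measures on a hypergroup. -/
def conv (μ ν : ProbabilityMeasure K) : ProbabilityMeasure K :=
  ⟨convMeasure (μ : Measure K) (ν : Measure K),
    isProbabilityMeasure_extendConv (c := Hypergroup.pointConv) Hypergroup.continuous_pointConv
      (μ : Measure K) (ν : Measure K)⟩

/-- A right-invariant Haar measure: a nonzero Radon measure `m` with `m * δ_x = m` for all `x`. -/
structure IsRightHaarMeasure (m : Measure K) : Prop where
  regular : m.Regular
  ne_zero : m ≠ 0
  right_invariant : ∀ x : K, convMeasure m (Measure.dirac x) = m

/-- The products `ν_n = μ_n * ⋯ * μ_1 * μ_0` (the sequence is indexed from `0`). -/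
def leftProd (μ : ℕ → ProbabilityMeasure K) : ℕ → ProbabilityMeasure K
  | 0 => μ 0
  | n + 1 => conv (μ (n + 1)) (leftProd μ n)

variable (K) in
/-- The normed convergence property: for every sequence `(μ_n)` of probability measures there are
points `x_n` such that `(δ_{x_n} * ν_n)` is relatively compact in the space of probability measures
with the weak topology, where `ν_n = μ_n * ⋯ * μ_1 * μ_0`. -/
def NormedConvergenceProperty : Prop :=
  ∀ μ : ℕ → ProbabilityMeasure K, ∃ x : ℕ → K,
    IsCompact (closure (Set.range fun n =>
      conv (diracProba (x n)) (leftProd μ n)))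

end Hypergroup

end

open MeasureTheory Topology Filter
open scoped ENNReal

noncomputable section

/-! If `K` is compact, so is its space of probability measures, and any choice of `x_n` works. If
`K` is not compact, one further left factor can disperse any given ν: for compact C there is μ =
½(δ_e + δ_y) with (δ_x * μ * ν)(C) ≤ 3/4 for every x at once (`exists_conv_diracProba_conv_le`).
Indeed, let T be a compact set carrying at least 3/4 of ν, and D = C * T⁻. Up to ν(Tᶜ), mass reaches
C only from mass that δ_x * μ puts on D. For y far away, D * y misses D, so x and x * y cannot both
charge D, and D receives at most ½.

Doing this along a compact exhaustion gives a sequence whose translated products never put more than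
3/4 of their mass on a fixed compact set from some index on. A limit point would then have total
mass at most 3/4. -/

theorem MeasureTheory.Measure.support_dirac {X : Type*} [TopologicalSpace X] [T1Space X]
    [MeasurableSpace X] [OpensMeasurableSpace X] (x : X) : (Measure.dirac x).support = {x} := by
  ext y
  constructor
  · intro hy
    exact Measure.support_subset_of_isClosed isClosed_singleton (by simp) hy
  · rintro rfl
    rw [Measure.mem_support_iff_forall]
    intro U hU
    rw [Measure.dirac_apply_of_mem (mem_of_mem_nhds hU)]
    exact one_pos

namespace Hypergroup

variable {K : Type*} [TopologicalSpace K] [T2Space K] [LocallyCompactSpace K]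
  [SecondCountableTopology K] [MeasurableSpace K] [BorelSpace K] [Hypergroup K]

/-- The support of `δ_x * δ_y`. -/
def pointSupport (x y : K) : Set K := (pointConv x y : Measure K).support

theorem measurable_pointConv :
    Measurable fun p : K × K => (pointConv p.1 p.2 : Measure K) :=
  measurable_of_continuous continuous_pointConv

theorem measurable_pointConv_apply {A : Set K} (hA : MeasurableSet A) :
    Measurable fun p : K × K => (pointConv p.1 p.2 : Measure K) A :=
  (Measure.measurable_coe hA).comp measurable_pointConv

theorem lintegral_convMeasure (μ ν : Measure K) [SFinite μ] [SFinite ν] {f : K → ℝ≥0∞}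
    (hf : Measurable f) :
    ∫⁻ z, f z ∂(convMeasure μ ν) =
      ∫⁻ x, ∫⁻ y, ∫⁻ z, f z ∂(pointConv x y : Measure K) ∂ν ∂μ := by
  rw [convMeasure, extendConv,
    Measure.lintegral_bind measurable_pointConv.aemeasurable hf.aemeasurable,
    lintegral_prod (fun p : K × K => ∫⁻ z, f z ∂(pointConv p.1 p.2 : Measure K))
      ((Measure.measurable_lintegral hf).comp measurable_pointConv).aemeasurable]

theorem convMeasure_apply (μ ν : Measure K) [SFinite μ] [SFinite ν] {A : Set K}
    (hA : MeasurableSet A) :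
    convMeasure μ ν A = ∫⁻ x, ∫⁻ y, (pointConv x y : Measure K) A ∂ν ∂μ := by
  rw [convMeasure, extendConv, Measure.bind_apply hA measurable_pointConv.aemeasurable,
    lintegral_prod _ (measurable_pointConv_apply hA).aemeasurable]

theorem convMeasure_dirac_left (x : K) (ν : Measure K) [SFinite ν] {A : Set K}
    (hA : MeasurableSet A) :
    convMeasure (Measure.dirac x) ν A = ∫⁻ y, (pointConv x y : Measure K) A ∂ν := by
  rw [convMeasure_apply _ _ hA, lintegral_dirac' _
    (Measurable.lintegral_prod_right' (measurable_pointConv_apply hA))]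

theorem convMeasure_dirac_right (μ : Measure K) [SFinite μ] (y : K) {A : Set K}
    (hA : MeasurableSet A) :
    convMeasure μ (Measure.dirac y) A = ∫⁻ x, (pointConv x y : Measure K) A ∂μ := by
  rw [convMeasure_apply _ _ hA]
  refine lintegral_congr fun x => ?_
  exact lintegral_dirac' _ ((measurable_pointConv_apply hA).comp measurable_prodMk_left)

/-! ### Calculus of supports -/

/-- The product `A * B` of compact sets is compact. -/
theorem isCompact_biUnion_pointSupport {P : Set (K × K)} (hP : IsCompact P) :
    IsCompact (⋃ p ∈ P, pointSupport p.1 p.2) := by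
  let F : K × K → TopologicalSpace.Compacts K :=
    fun p => ⟨pointSupport p.1 p.2, isCompact_support p.1 p.2⟩
  have hF : Continuous F :=
    letI := TopologicalSpace.vietoris K
    (TopologicalSpace.Compacts.isEmbedding_coe (α := K)).continuous_iff.2 continuous_support
  have h := TopologicalSpace.Compacts.isCompact_biUnion_coe_of_isCompact (hP.image hF)
  rwa [Set.biUnion_image] at h

theorem pointConv_eq_zero_of_disjoint {x y : K} {A : Set K}
    (h : Disjoint (pointSupport x y) A) : (pointConv x y : Measure K) A = 0 :=
  measure_mono_null h.subset_compl_left Measure.measure_compl_support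

/-- The union of the supports of δ_s * δ_t is compact, hence closed, and carries all the mass.
Conversely, (s, t) ↦ (δ_s * δ_t)(U) is lower semicontinuous for open U, so positivity at one point
spreads to a neighbourhood of positive μ × ν measure. -/
theorem mem_support_convMeasure_iff {μ ν : Measure K} [IsProbabilityMeasure μ]
    [IsProbabilityMeasure ν] (hμ : IsCompact μ.support) (hν : IsCompact ν.support) (w : K) :
    w ∈ (convMeasure μ ν).support ↔ ∃ s ∈ μ.support, ∃ t ∈ ν.support, w ∈ pointSupport s t := by
  constructor
  · intro hw
    set C := ⋃ p ∈ μ.support ×ˢ ν.support, pointSupport p.1 p.2 with hC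
    have hCc : IsClosed C := (isCompact_biUnion_pointSupport (hμ.prod hν)).isClosed
    have hmem : w ∈ C := by
      refine Measure.support_subset_of_isClosed hCc ?_ hw
      rw [mem_ae_iff, convMeasure_apply _ _ hCc.measurableSet.compl]
      rw [lintegral_eq_zero_of_ae_eq_zero]
      filter_upwards [Measure.support_mem_ae (μ := μ)] with s hs
      refine lintegral_eq_zero_of_ae_eq_zero ?_
      filter_upwards [Measure.support_mem_ae (μ := ν)] with t ht
      refine pointConv_eq_zero_of_disjoint (Set.disjoint_compl_right_iff_subset.2 ?_)
      exact Set.subset_biUnion_of_mem (u := fun p : K × K => pointSupport p.1 p.2)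
        (Set.mk_mem_prod hs ht)
    simp only [hC, Set.mem_iUnion, Set.mem_prod] at hmem
    obtain ⟨p, ⟨h1, h2⟩, h⟩ := hmem
    exact ⟨p.1, h1, p.2, h2, h⟩
  · rintro ⟨s, hs, t, ht, hw⟩
    rw [Measure.support_eq_forall_isOpen]
    intro U hwU hU
    have hpos : 0 < (pointConv s t : Measure K) U :=
      (Measure.mem_support_iff_forall w).1 hw U (hU.mem_nhds hwU)
    have hlsc : LowerSemicontinuous fun p : K × K => (pointConv p.1 p.2 : Measure K) U := by
      rw [lowerSemicontinuous_iff_le_liminf]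
      exact fun p =>
        ProbabilityMeasure.le_liminf_measure_open_of_tendsto (continuous_pointConv.tendsto p) hU
    have hnhds : {p : K × K | 0 < (pointConv p.1 p.2 : Measure K) U} ∈ 𝓝 (s, t) :=
      hlsc (s, t) 0 hpos
    obtain ⟨V, hV, W, hW, hVW⟩ := mem_nhds_prod_iff.1 hnhds
    have hVpos := (Measure.mem_support_iff_forall s).1 hs V hV
    have hWpos := (Measure.mem_support_iff_forall t).1 ht W hW
    have hprod : 0 < (μ.prod ν) (V ×ˢ W) := by
      rw [Measure.prod_prod]
      exact ENNReal.mul_pos hVpos.ne' hWpos.ne'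
    rw [convMeasure, extendConv, Measure.bind_apply hU.measurableSet
      measurable_pointConv.aemeasurable,
      lintegral_pos_iff_support (measurable_pointConv_apply hU.measurableSet)]
    exact hprod.trans_le (measure_mono fun p hp => (hVW hp).ne')

/-- Supports are associative: `({x} * {y}) * {z} = {x} * ({y} * {z})`. -/
theorem exists_mem_pointSupport_assoc (x y z w : K) :
    (∃ s ∈ pointSupport x y, w ∈ pointSupport s z) ↔
      ∃ t ∈ pointSupport y z, w ∈ pointSupport x t := by
  have h : (convMeasure (pointConv x y : Measure K) (Measure.dirac z)).support =
      (convMeasure (Measure.dirac x) (pointConv y z : Measure K)).support :=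
    congrArg Measure.support (pointConv_assoc x y z)
  have h1 := mem_support_convMeasure_iff (μ := (pointConv x y : Measure K))
    (ν := Measure.dirac z) (isCompact_support x y) (by simp [Measure.support_dirac]) w
  have h2 := mem_support_convMeasure_iff (μ := Measure.dirac x)
    (ν := (pointConv y z : Measure K)) (by simp [Measure.support_dirac]) (isCompact_support y z) w
  rw [h, h2] at h1
  simpa [Measure.support_dirac, pointSupport] using h1.symm

theorem e_mem_pointSupport_iff (x y : K) : e ∈ pointSupport x y ↔ x = invol y :=
  e_mem_support_iff x y

theorem invol_mem_pointSupport {x y z : K} (h : z ∈ pointSupport x y) :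
    invol z ∈ pointSupport (invol y) (invol x) := by
  rw [pointSupport, Measure.mem_support_iff_forall] at h ⊢
  intro U hU
  rw [← map_invol_pointConv x y]
  exact (h _ (continuous_invol.continuousAt.preimage_mem_nhds hU)).trans_le
    (Measure.le_map_apply continuous_invol.measurable.aemeasurable U)

/-- A substitute for cancellation: e lies in {z} * {z⁻} ⊆ {x} * ({y} * {z⁻}), so x = u⁻ for some u
in {y} * {z⁻}, and the involution finishes. -/
theorem left_mem_pointSupport {x y z : K} (h : z ∈ pointSupport x y) :
    x ∈ pointSupport z (invol y) := by
  have h1 : (e : K) ∈ pointSupport z (invol z) := by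
    rw [e_mem_pointSupport_iff, invol_invol]
  obtain ⟨u, hu, hue⟩ := (exists_mem_pointSupport_assoc x y (invol z) e).1 ⟨z, h, h1⟩
  rw [e_mem_pointSupport_iff] at hue
  have := invol_mem_pointSupport hu
  rwa [invol_invol, ← hue] at this

theorem right_mem_pointSupport {x y z : K} (h : z ∈ pointSupport x y) :
    y ∈ pointSupport (invol x) z := by
  have := invol_mem_pointSupport (left_mem_pointSupport (invol_mem_pointSupport h))
  simpa [invol_invol] using this

theorem lintegral_pointConv_assoc (x s t : K) {C : Set K} (hC : MeasurableSet C) :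
    ∫⁻ r, (pointConv r t : Measure K) C ∂(pointConv x s : Measure K) =
      ∫⁻ z, (pointConv x z : Measure K) C ∂(pointConv s t : Measure K) := by
  rw [← convMeasure_dirac_left x _ hC, ← convMeasure_dirac_right _ t hC]
  exact congrArg (fun m : Measure K => m C) (pointConv_assoc x s t)

/-- `(δ_x * (μ * ν))(C) = ∫∫ ((δ_x * δ_s) * δ_t)(C) dν(t) dμ(s)`. -/
theorem conv_diracProba_conv_apply (x : K) (μ ν : ProbabilityMeasure K) {C : Set K}
    (hC : MeasurableSet C) :
    (conv (diracProba x) (conv μ ν) : Measure K) C =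
      ∫⁻ s, ∫⁻ t, ∫⁻ r, (pointConv r t : Measure K) C ∂(pointConv x s : Measure K)
        ∂(ν : Measure K) ∂(μ : Measure K) := by
  have h1 : (conv (diracProba x) (conv μ ν) : Measure K) C =
      ∫⁻ z, (pointConv x z : Measure K) C ∂(convMeasure (μ : Measure K) (ν : Measure K)) := by
    have : IsProbabilityMeasure (convMeasure (μ : Measure K) (ν : Measure K)) := (conv μ ν).2
    exact convMeasure_dirac_left x _ hC
  rw [h1, lintegral_convMeasure _ _ (f := fun z => (pointConv x z : Measure K) C)
    ((measurable_pointConv_apply hC).comp measurable_prodMk_left)]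
  simp_rw [lintegral_pointConv_assoc _ _ _ hC]

/-! ### Dispersing a measure by a left factor -/

theorem lintegral_pointConv_le {x s t : K} {C D : Set K} (hD : MeasurableSet D)
    (h : ∀ r, (pointSupport r t ∩ C).Nonempty → r ∈ D) :
    ∫⁻ r, (pointConv r t : Measure K) C ∂(pointConv x s : Measure K) ≤
      (pointConv x s : Measure K) D := by
  rw [← lintegral_indicator_one hD]
  refine lintegral_mono fun r => ?_
  by_cases hr : r ∈ D
  · simpa [hr] using prob_le_one
  · have : Disjoint (pointSupport r t) C :=
      Set.disjoint_iff_inter_eq_empty.2 (Set.not_nonempty_iff_eq_empty.1 fun h' => hr (h r h'))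
    simp [pointConv_eq_zero_of_disjoint this]

/-- `½ (δ_x + δ_y)`. -/
def midpointDirac (x y : K) : ProbabilityMeasure K :=
  ⟨(2⁻¹ : ℝ≥0∞) • (Measure.dirac x + Measure.dirac y), ⟨by
    simp [ENNReal.inv_two_add_inv_two]⟩⟩

theorem conv_diracProba_conv_midpointDirac_le (ν : ProbabilityMeasure K) {C D T : Set K}
    (hC : MeasurableSet C) (hD : MeasurableSet D) (hT : MeasurableSet T)
    (h : ∀ r, ∀ t ∈ T, (pointSupport r t ∩ C).Nonempty → r ∈ D) {y : K}
    (hy : ∀ d ∈ D, Disjoint (pointSupport d y) D) (x : K) :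
    (conv (diracProba x) (conv (midpointDirac e y) ν) : Measure K) C ≤
      2⁻¹ + (ν : Measure K) Tᶜ := by
  have key : ∀ s, ∫⁻ t, ∫⁻ r, (pointConv r t : Measure K) C ∂(pointConv x s : Measure K)
      ∂(ν : Measure K) ≤ (pointConv x s : Measure K) D + (ν : Measure K) Tᶜ := by
    intro s
    calc _ ≤ ∫⁻ t, ((pointConv x s : Measure K) D + Tᶜ.indicator 1 t) ∂(ν : Measure K) := by
          refine lintegral_mono fun t => ?_
          by_cases ht : t ∈ T
          · exact (lintegral_pointConv_le hD fun r hr => h r t ht hr).trans le_self_add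
          · have hle : ∫⁻ r, (pointConv r t : Measure K) C ∂(pointConv x s : Measure K) ≤ 1 := by
              calc _ ≤ ∫⁻ _, 1 ∂(pointConv x s : Measure K) :=
                    lintegral_mono fun r => prob_le_one
                _ = 1 := by simp
            simpa [ht] using hle.trans le_add_self
      _ = _ := by
          rw [lintegral_add_left measurable_const, lintegral_indicator_one hT.compl]
          simp
  -- If x ∈ D, the second term vanishes by the choice of y; otherwise the first does, being δ_x(D).
  have hsum : (pointConv x e : Measure K) D + (pointConv x y : Measure K) D ≤ 1 := by
    by_cases hx : x ∈ D
    · rw [pointConv_eq_zero_of_disjoint (hy x hx), add_zero]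
      exact prob_le_one
    · rw [pointConv_e, Measure.dirac_apply' _ hD]
      simpa [hx] using prob_le_one
  have hmeas : Measurable fun s : K => ∫⁻ t, ∫⁻ r, (pointConv r t : Measure K) C
      ∂(pointConv x s : Measure K) ∂(ν : Measure K) := by
    simp_rw [lintegral_pointConv_assoc _ _ _ hC]
    refine Measurable.lintegral_prod_right' (f := fun p : K × K =>
      ∫⁻ z, (pointConv x z : Measure K) C ∂(pointConv p.1 p.2 : Measure K)) ?_
    exact (Measure.measurable_lintegral
      ((measurable_pointConv_apply hC).comp measurable_prodMk_left)).comp measurable_pointConv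
  rw [conv_diracProba_conv_apply x _ ν hC]
  change ∫⁻ s, _ ∂((2⁻¹ : ℝ≥0∞) • (Measure.dirac e + Measure.dirac y)) ≤ _
  rw [lintegral_smul_measure, lintegral_add_measure, lintegral_dirac' _ hmeas,
    lintegral_dirac' _ hmeas, smul_eq_mul]
  calc _ ≤ 2⁻¹ * (((pointConv x e : Measure K) D + (ν : Measure K) Tᶜ) +
          ((pointConv x y : Measure K) D + (ν : Measure K) Tᶜ)) := by
        gcongr <;> exact key _
    _ = 2⁻¹ * ((pointConv x e : Measure K) D + (pointConv x y : Measure K) D) +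
          2⁻¹ * 2 * (ν : Measure K) Tᶜ := by ring
    _ ≤ 2⁻¹ * 1 + 1 * (ν : Measure K) Tᶜ := by
        gcongr
        rw [ENNReal.inv_mul_cancel two_ne_zero ENNReal.ofNat_ne_top]
    _ = _ := by simp

/-- On a noncompact hypergroup every probability measure can be dispersed by a left factor. -/
theorem exists_conv_diracProba_conv_le [NoncompactSpace K] (ν : ProbabilityMeasure K) {C : Set K}
    (hC : IsCompact C) :
    ∃ μ : ProbabilityMeasure K, ∀ x : K,
      (conv (diracProba x) (conv μ ν) : Measure K) C ≤ 2⁻¹ + 4⁻¹ := by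
  obtain ⟨T, -, hT, hlt⟩ := MeasurableSet.univ.exists_isCompact_sdiff_lt
    (measure_ne_top (ν : Measure K) Set.univ) (ε := 4⁻¹) (by simp)
  have hνT : (ν : Measure K) Tᶜ ≤ 4⁻¹ := by simpa [Set.compl_eq_univ_sdiff] using hlt.le
  set D : Set K := ⋃ p ∈ C ×ˢ (invol '' T), pointSupport p.1 p.2
  have hD : IsCompact D := isCompact_biUnion_pointSupport (hC.prod (hT.image continuous_invol))
  set E : Set K := ⋃ p ∈ (invol '' D) ×ˢ D, pointSupport p.1 p.2
  have hE : IsCompact E := isCompact_biUnion_pointSupport ((hD.image continuous_invol).prod hD)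
  -- With y outside D⁻ * D, no z ∈ D lies in {d} * {y} for d ∈ D, since that would put y in {d⁻} *
  -- {z}.
  obtain ⟨y, hy⟩ := (Set.ne_univ_iff_exists_notMem E).1 hE.ne_univ
  refine ⟨midpointDirac e y, fun x => (conv_diracProba_conv_midpointDirac_le ν hC.measurableSet
    hD.measurableSet hT.measurableSet ?_ ?_ x).trans (by gcongr)⟩
  · rintro r t ht ⟨z, hz, hzC⟩
    exact Set.mem_biUnion (x := (z, invol t)) ⟨hzC, Set.mem_image_of_mem _ ht⟩
      (left_mem_pointSupport hz)
  · intro d hd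
    rw [Set.disjoint_left]
    intro z hz hzD
    exact hy (Set.mem_biUnion (x := (invol d, z)) ⟨Set.mem_image_of_mem _ hd, hzD⟩
      (right_mem_pointSupport hz))

/-! ### The dispersed sequence and its limit points -/

theorem exists_leftProd_dispersed [NoncompactSpace K] {C : ℕ → Set K}
    (hC : ∀ n, IsCompact (C n)) :
    ∃ μ : ℕ → ProbabilityMeasure K, ∀ n x,
      (conv (diracProba x) (leftProd μ (n + 1)) : Measure K) (C n) ≤ 2⁻¹ + 4⁻¹ := by
  choose M hM using fun (n : ℕ) (ν : ProbabilityMeasure K) =>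
    exists_conv_diracProba_conv_le ν (hC n)
  -- Each factor depends on the product so far, so the products `N` are built first and the factors
  -- `μ` read off from them, starting from δ_e.
  let N : ℕ → ProbabilityMeasure K :=
    fun n => Nat.rec (diracProba e) (fun n ν => conv (M n ν) ν) n
  let μ : ℕ → ProbabilityMeasure K := fun n => Nat.casesOn n (diracProba e) fun n => M n (N n)
  have hN : ∀ n, leftProd μ n = N n := by
    intro n
    induction n with
    | zero => rfl
    | succ n ih => rw [leftProd, ih]
  refine ⟨μ, fun n x => ?_⟩
  rw [hN]
  exact hM n (N n) x

theorem compactSpace_of_normedConvergenceProperty (h : NormedConvergenceProperty K) :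
    CompactSpace K := by
  by_contra hK
  rw [not_compactSpace_iff] at hK
  let C : CompactExhaustion K := default
  obtain ⟨μ, hμ⟩ := exists_leftProd_dispersed C.isCompact
  obtain ⟨x, hx⟩ := h μ
  set ρ : ℕ → ProbabilityMeasure K := fun n => conv (diracProba (x n)) (leftProd μ n) with hρ
  -- Convergence along an ultrafilter finer than `atTop` replaces the extraction of a subsequence.
  let f : Ultrafilter ℕ := Ultrafilter.of atTop
  have hf : (f : Filter ℕ) ≤ atTop := Ultrafilter.of_le atTop
  obtain ⟨lam, -, hlam⟩ := hx.ultrafilter_le_nhds (f.map ρ)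
    (le_principal_iff.2 (Ultrafilter.mem_coe.1 (by
      rw [Ultrafilter.coe_map]
      exact mem_map.2 (Eventually.of_forall fun n => subset_closure (Set.mem_range_self n)))))
  have hlim : Tendsto ρ f (𝓝 lam) := hlam
  -- Interiors are used because mass on open sets is lower semicontinuous under weak limits; they
  -- still exhaust `K`.
  have hbound : ∀ k, (lam : Measure K) (interior (C k)) ≤ 2⁻¹ + 4⁻¹ := by
    intro k
    refine (ProbabilityMeasure.le_liminf_measure_open_of_tendsto hlim isOpen_interior).trans ?_
    refine liminf_le_of_frequently_le' (Eventually.frequently ?_)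
    filter_upwards [hf (eventually_ge_atTop (k + 1))] with n hn
    obtain ⟨m, rfl⟩ : ∃ m, n = m + 1 := ⟨n - 1, by omega⟩
    exact (measure_mono (interior_subset.trans (C.subset (by omega)))).trans (hμ m _)
  have hunion : ⋃ k, interior (C k) = Set.univ := by
    rw [Set.eq_univ_iff_forall]
    intro z
    obtain ⟨k, hk⟩ := C.exists_mem z
    exact Set.mem_iUnion.2 ⟨k + 1, C.subset_interior_succ k hk⟩
  have hmono : Monotone fun k => interior (C k) := fun a b hab => interior_mono (C.subset hab)
  have hone : (lam : Measure K) Set.univ ≤ 2⁻¹ + 4⁻¹ := by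
    rw [← hunion, hmono.measure_iUnion]
    exact iSup_le hbound
  rw [measure_univ] at hone
  have : (1 : ℝ) ≤ 2⁻¹ + 4⁻¹ := by
    have := ENNReal.toReal_mono (by simp) hone
    rwa [ENNReal.toReal_add (by simp) (by simp), ENNReal.toReal_inv, ENNReal.toReal_inv] at this
  norm_num at this

theorem normedConvergenceProperty_of_compactSpace [CompactSpace K] :
    NormedConvergenceProperty K :=
  fun _ => ⟨fun _ => e, isClosed_closure.isCompact⟩

end Hypergroup

end

theorem theorem1 {K : Type*} [TopologicalSpace K] [T2Space K] [LocallyCompactSpace K]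
    [SecondCountableTopology K] [MeasurableSpace K] [BorelSpace K] [Hypergroup K]
    (hm : ∃ m : MeasureTheory.Measure K, Hypergroup.IsRightHaarMeasure m) :
    Hypergroup.NormedConvergenceProperty K ↔ CompactSpace K :=
  ⟨Hypergroup.compactSpace_of_normedConvergenceProperty,
    fun _ => Hypergroup.normedConvergenceProperty_of_compactSpace⟩
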